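/- \textbf{Setting.} Let $G=(V,E,w)$ be a finite connected graph with positive edge weights, $d$ its weighted distance, with $d(u,v)\ge 1$ for $u\neq v$, and with diameter $D\ge 2$. Let $N_y(v)=\{u: d(v,u)\le y\}$. The doubling dimension of $G$ is at most $\delta$ if every ball $N_r(v)$ is covered by at most $2^\delta$ balls of radius $r/2$. One object is initially at a node $v'$, and each transaction $T\in\mathcal T$ (finitely many) is initially at a node $\mathrm{home}(T)$, at most one transaction per node. Moving the object (a transaction) over distance $x$ costs $\alpha x$ (respectively $\beta x$), where $\alpha>\beta>0$. A schedule moves the object along a walk of $G$ starting at $v'$ and each transaction along a walk of $G$ from its home to some node on the walk of the object; its cost is $\alpha$ times the length of the object's walk plus $\beta$ times the total length of the walks of the transactions. $C^*$ is the infimum of the costs of all schedules. \textbf{Hierarchy.} For $\sigma\ge1$ and $I\in\mathbb N$ put $\rho=4\sigma$ and $h=\lceil\log_\rho D\rceil$. A hierarchy $H$ with parameters $(\sigma,I)$ consists of partitions $\mathcal P_0,\dots,\mathcal P_h$ of $V$ with a leader chosen in each cluster, such that, with $r_l=\min(D,\rho^l)$, every cluster of $\mathcal P_l$ has $d$-diameter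 at most $\sigma r_l$, every $N_{r_l}(v)$ meets at most $I$ clusters of $\mathcal P_l$, and $\mathcal P_h=\{V\}$. \textbf{Algorithm GlobalAware\_SingleObj.} Let $\gamma=\lceil\alpha/\beta\rceil$. For $l=0,\dots,h$ and each $X\in\mathcal P_l$: if at least $2\gamma$ transactions with home in $X$ have no dedicated super-leader yet, they all get the leader of $X$ as their dedicated super-leader. Let $\widehat T_l$ be the set of transactions that get one at level $l$, and $\widehat L_l$ the set of these super-leaders. Let $R=\{l\le h: |\widehat T_l|\ge 8I\alpha/\beta\}$ and $S_f=\bigcup_{l\in R}\widehat L_l$. The transactions in $\bigcup_{l\in R}\widehat T_l$ move to their dedicated super-leaders, and all others to $v'$, along shortest paths. The object goes round a tour of $S_f\cup\{v'\}$, from $v'$ back to $v'$, along shortest paths between consecutive nodes of the tour. The tour is \emph{MST-based} if it comes from a minimum-weight spanning tree of the complete graph on $S_f\cup\{v'\}$ with edge weights $d$, by shortcutting an Eulerian circuit of the doubled tree so that each node occurs once. $\mathrm{Tour}^*$ is the minimal length of a closed walk in $G$ through all nodes of $S_f\cup\{v'\}$. \textbf{Claim.} For every $\delta$: (a) there are $\sigma\ge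 1$ and $I$, depending only on $\delta$, such that every finite connected positively weighted graph of doubling dimension at most $\delta$ has a hierarchy with parameters $(\sigma,I)$; (b) for all $\sigma\ge1$ and $I$ there is a constant $K$, depending only on $\delta,\sigma,I$, such that for all data as above (with $G$ of doubling dimension at most $\delta$, and any hierarchy $H$ with parameters $(\sigma,I)$), MST-based tours of $S_f\cup\{v'\}$ exist, and for each of them the length of the tour is at most $2\,\mathrm{Tour}^*$ and the total cost of the schedule produced by GlobalAware\_SingleObj is at most $K\cdot\log D\cdot C^*$. Thus, on graphs of constant doubling dimension, GlobalAware\_SingleObj with an MST-based tour is an $O(\log D)$-approximation of the optimal communication cost. -/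

import Mathlib

open Finset

noncomputable section

namespace DualFlow

/-! ### Weighted graphs -/

/-- A connected (undirected) graph with positive edge weights. -/
structure WeightedGraph (V : Type*) where
  graph : SimpleGraph V
  connected : graph.Connected
  weight : Sym2 V → ℝ
  weight_pos : ∀ e ∈ graph.edgeSet, 0 < weight e

namespace WeightedGraph

variable {V : Type*} (G : WeightedGraph V)

/-- The length of a walk: the sum of the weights of its edges, with multiplicity. -/
def walkLength {u v : V} (p : G.graph.Walk u v) : ℝ :=
  (p.edges.map G.weight).sum

/-- The weighted distance: the infimum of the lengths of the walks between the two nodes. -/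
def dist (u v : V) : ℝ := ⨅ p : G.graph.Walk u v, G.walkLength p

/-- The diameter: the largest distance between two nodes (used for finite `V` only). -/
def diam : ℝ := ⨆ p : V × V, G.dist p.1 p.2

/-- The neighbourhood `N_y(v)`, i.e. the closed ball of radius `y` about `v`. -/
def nbhd (v : V) (y : ℝ) : Set V := {u | G.dist v u ≤ y}

/-- The doubling dimension is at most `δ`: every ball is covered by at most `2 ^ δ` balls of half
its radius. -/
def DoublingDimLE (δ : ℝ) : Prop :=
  ∀ (v : V) (r : ℝ), 0 ≤ r →
    ∃ C : Finset V, (#C : ℝ) ≤ (2 : ℝ) ^ δ ∧ G.nbhd v r ⊆ ⋃ c ∈ C, G.nbhd c (r / 2)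

theorem walkLength_nonneg {u v : V} (p : G.graph.Walk u v) : 0 ≤ G.walkLength p := by
  refine List.sum_nonneg fun x hx => ?_
  obtain ⟨e, he, rfl⟩ := List.mem_map.1 hx
  exact (G.weight_pos e (p.edges_subset_edgeSet he)).le

theorem dist_comm (u v : V) : G.dist u v = G.dist v u := by
  have key : ∀ {a b : V} (p : G.graph.Walk a b), G.walkLength p.reverse = G.walkLength p := by
    intro a b p
    simp [walkLength, List.sum_reverse]
  unfold dist
  exact Equiv.iInf_congr
    ⟨fun p => p.reverse, fun p => p.reverse, fun p => by simp, fun p => by simp⟩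
    (fun p => key p)

/-- In a finite graph the distance is attained. -/
theorem exists_shortest [Finite V] (u v : V) :
    ∃ p : G.graph.Walk u v, G.walkLength p = G.dist u v := by
  classical
  have := Fintype.ofFinite V
  have : Nonempty (G.graph.Path u v) := ⟨(G.connected u v).some.toPath⟩
  have : Nonempty (G.graph.Walk u v) := ⟨(G.connected u v).some⟩
  have : Finite (G.graph.Path u v) := Finite.of_fintype _
  obtain ⟨p, hp⟩ := Finite.exists_min (fun p : G.graph.Path u v => G.walkLength p.1)
  refine ⟨p.1, le_antisymm (le_ciInf fun q => (hp q.toPath).trans ?_)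
    (ciInf_le ⟨0, by rintro _ ⟨q, rfl⟩; exact G.walkLength_nonneg q⟩ p.1)⟩
  refine List.Sublist.sum_le_sum ((SimpleGraph.Walk.edges_bypass_sublist_edges q).map _) fun x hx => ?_
  obtain ⟨e, he, rfl⟩ := List.mem_map.1 hx
  exact (G.weight_pos e (q.edges_subset_edgeSet he)).le

/-- A chosen shortest walk. -/
def shortestWalk [Finite V] (u v : V) : G.graph.Walk u v := (G.exists_shortest u v).choose

/-- Start at `u`, visit the nodes of the list one after the other, finish at `t`, always moving
along shortest walks. -/
def walkVia [Finite V] (t : V) : (u : V) → List V → G.graph.Walk u t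
  | u, [] => G.shortestWalk u t
  | u, v :: l => (G.shortestWalk u v).append (walkVia t v l)

theorem mem_support_walkVia [Finite V] (t : V) {x : V} :
    ∀ (l : List V) (u : V), x ∈ u :: l → x ∈ (G.walkVia t u l).support
  | [], u, h => by
    rw [List.mem_singleton.1 h]
    exact SimpleGraph.Walk.start_mem_support _
  | v :: l, u, h => by
    rcases List.mem_cons.1 h with rfl | h
    · exact SimpleGraph.Walk.start_mem_support _
    · rw [walkVia, SimpleGraph.Walk.mem_support_append_iff]
      exact Or.inr (mem_support_walkVia t l v h)

end WeightedGraph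

/-! ### Schedules in the dual-flow model -/

section Schedules

variable {V τ : Type*} (G : WeightedGraph V)

/-- A schedule for one object, initially at `v₀`, and transactions `T : τ`, initially at `home T`:
the object moves along a walk of `G`, and every transaction moves along a walk of `G` to a node
on the object's walk, where it is executed. -/
structure Schedule (v₀ : V) (home : τ → V) where
  objEnd : V
  objWalk : G.graph.Walk v₀ objEnd
  site : τ → V
  site_mem : ∀ T, site T ∈ objWalk.support
  txnWalk : ∀ T, G.graph.Walk (home T) (site T)

/-- The communication cost: `α` (resp. `β`) per unit length for the object (resp. for each
transaction). -/
def Schedule.cost [Fintype τ] {G : WeightedGraph V} {v₀ : V} {home : τ → V}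
    (s : Schedule G v₀ home) (α β : ℝ) : ℝ :=
  α * G.walkLength s.objWalk + β * ∑ T, G.walkLength (s.txnWalk T)

/-- The optimal cost `C*`. -/
def optCost [Fintype τ] (v₀ : V) (home : τ → V) (α β : ℝ) : ℝ :=
  ⨅ s : Schedule G v₀ home, s.cost α β

/-- The optimal length of a TSP tour of `S`: a closed walk of `G` through `v₀` that visits all
nodes of `S`. -/
def optTour (S : Finset V) (v₀ : V) : ℝ :=
  ⨅ p : {p : G.graph.Walk v₀ v₀ // ∀ x ∈ S, x ∈ p.support}, G.walkLength p.1

end Schedules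

/-! ### Partition hierarchies -/

section Hierarchies

variable {V : Type*} [Fintype V] [DecidableEq V] (G : WeightedGraph V)

/-- `P` is an `(r, σ, I)`-partition: all clusters have (weak) diameter at most `r * σ`, and every
`r`-neighbourhood meets at most `I` clusters. -/
def IsPartition (r σ : ℝ) (I : ℕ) (P : Finpartition (univ : Finset V)) : Prop :=
  (∀ X ∈ P.parts, ∀ u ∈ X, ∀ v ∈ X, G.dist u v ≤ r * σ) ∧
  ∀ v : V, {X : Finset V | X ∈ P.parts ∧ ((X : Set V) ∩ G.nbhd v r).Nonempty}.ncard ≤ I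

/-- The top level `h = ⌈log_ρ D⌉` with `ρ = 4 σ`. -/
def topLevel (σ : ℝ) : ℕ := ⌈Real.logb (4 * σ) G.diam⌉₊

/-- A partition hierarchy with parameters `σ` and `I`: for `0 ≤ l ≤ h` an
`(r_l, σ, I)`-partition with `r_l = min D (ρ ^ l)`, which for `l = h` consists of the single
cluster `V`, and a leader in each cluster. The values at levels above `h` are irrelevant, and the
level `-1` (all clusters are single nodes) carries no information. -/
structure Hierarchy (σ : ℝ) (I : ℕ) where
  part : ℕ → Finpartition (univ : Finset V)
  isPartition : ∀ l ≤ topLevel G σ, IsPartition G (min G.diam ((4 * σ) ^ l)) σ I (part l)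
  top : (part (topLevel G σ)).parts = {univ}
  leader : ℕ → Finset V → V
  leader_mem : ∀ l ≤ topLevel G σ, ∀ X ∈ (part l).parts, leader l X ∈ X

end Hierarchies

/-! ### The algorithm `GlobalAware_SingleObj` -/

section Algorithm

variable {V τ : Type*} [Fintype V] [DecidableEq V] [Fintype τ]
  {G : WeightedGraph V} {σ : ℝ} {I : ℕ} (H : Hierarchy G σ I) (v₀ : V) (home : τ → V) (α β : ℝ)

/-- The members of `U` (transactions) that are located in `X`. -/
def txnsIn (U : Finset τ) (X : Finset V) : Finset τ := U.filter fun T => home T ∈ X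

/-- The leader of `X` becomes a super-leader, where `U` is the set of the transactions that are
not assigned yet: `X` contains at least `2 γ` of them, `γ = ⌈α / β⌉`. -/
def Qualifies (U : Finset τ) (X : Finset V) : Prop :=
  2 * ⌈α / β⌉₊ ≤ #(txnsIn home U X)

open Classical in
/-- The transactions that have no dedicated super-leader when level `l` is about to be
processed. -/
def unassigned : ℕ → Finset τ
  | 0 => univ
  | l + 1 => (unassigned l).filter fun T =>
      ¬ Qualifies home α β (unassigned l) ((H.part l).part (home T))

open Classical in
/-- The set `T̂_l` of the transactions that are assigned a dedicated super-leader at level `l`. -/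
def assignedAt (l : ℕ) : Finset τ :=
  (unassigned H home α β l).filter fun T =>
    Qualifies home α β (unassigned H home α β l) ((H.part l).part (home T))

/-- The leader of the cluster of `T` at level `l`. -/
def leaderOf (l : ℕ) (T : τ) : V := H.leader l ((H.part l).part (home T))

/-- The set `L̂_l` of the dedicated super-leaders at level `l`. -/
def dedicatedAt (l : ℕ) : Finset V := (assignedAt H home α β l).image (leaderOf H home l)

open Classical in
/-- The set `R` of the levels that survive the pruning. The threshold is `8 I α` in units in which
`β = 1`. -/
def keptLevels : Finset ℕ :=
  (range (topLevel G σ + 1)).filter fun l =>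
    8 * (I : ℝ) * (α / β) ≤ (#(assignedAt H home α β l) : ℝ)

/-- The final set `S_f` of dedicated super-leaders. -/
def finalLeaders : Finset V := (keptLevels H home α β).biUnion (dedicatedAt H home α β)

open Classical in
/-- The node to which the transaction `T` is moved: its dedicated super-leader, if it has got one
at a level that survives the pruning, and `v₀` otherwise. -/
def destination (T : τ) : V :=
  if hT : ∃ l ∈ keptLevels H home α β, T ∈ assignedAt H home α β l then
    leaderOf H home hT.choose T
  else v₀

/-- The nodes of the tour of the object. -/
def tourNodes : Finset V := insert v₀ (finalLeaders H home α β)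

theorem destination_mem (T : τ) :
    destination H v₀ home α β T ∈ tourNodes H v₀ home α β := by
  unfold destination tourNodes
  split_ifs with hT
  · exact mem_insert_of_mem (mem_biUnion.2
      ⟨_, hT.choose_spec.1, mem_image_of_mem _ hT.choose_spec.2⟩)
  · exact mem_insert_self _ _

end Algorithm

/-! ### Tours from minimum spanning trees -/

section MST

variable {V : Type*} [DecidableEq V] (G : WeightedGraph V)

open Classical in
/-- The weight of a graph on `S`, as a subgraph of the complete graph on `S` with edge weights
given by the distances in `G`. -/
def metricWeight (S : Finset V) (T : SimpleGraph S) : ℝ :=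
  ∑ e : T.edgeSet,
    Sym2.lift ⟨fun a b : S => G.dist a b, fun a b => G.dist_comm a b⟩ (e : Sym2 S)

/-- A tour of `S` from a minimum spanning tree of the complete graph on `S` with the distances of
`G` as edge weights: an Eulerian circuit of the doubled tree from `v₀` to `v₀`, shortcut so that
each node occurs once. The tour is `v₀`, then `stops`, then back to `v₀`. -/
structure MSTTour (S : Finset V) (v₀ : V) where
  mem : v₀ ∈ S
  tree : SimpleGraph S
  isTree : tree.IsTree
  minimal : ∀ T : SimpleGraph S, T.IsTree → metricWeight G S tree ≤ metricWeight G S T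
  circuit : tree.Walk ⟨v₀, mem⟩ ⟨v₀, mem⟩
  twice : ∀ e ∈ tree.edgeSet, circuit.edges.count e = 2
  stops : List S
  shortcut : (⟨v₀, mem⟩ :: stops).Sublist circuit.support
  nodup : (⟨v₀, mem⟩ :: stops : List S).Nodup
  visits : ∀ x : S, x ∈ (⟨v₀, mem⟩ :: stops : List S)

/-- The walk of the object along the tour. -/
def MSTTour.walk [Finite V] {G : WeightedGraph V} {S : Finset V} {v₀ : V} (t : MSTTour G S v₀) :
    G.graph.Walk v₀ v₀ :=
  G.walkVia v₀ v₀ (t.stops.map Subtype.val)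

theorem MSTTour.mem_walk [Finite V] {G : WeightedGraph V} {S : Finset V} {v₀ : V}
    (t : MSTTour G S v₀) {x : V} (hx : x ∈ S) : x ∈ t.walk.support := by
  refine G.mem_support_walkVia v₀ _ _ ?_
  have := List.mem_map_of_mem (f := Subtype.val) (t.visits ⟨x, hx⟩)
  simpa using this

end MST

/-- The schedule produced by `GlobalAware_SingleObj` with an MST-based tour: every transaction
moves to its destination along a shortest walk, and the object goes round the tour. -/
def globalAwareSingleObj {V τ : Type*} [Fintype V] [DecidableEq V] [Fintype τ]
    {G : WeightedGraph V} {σ : ℝ} {I : ℕ} (H : Hierarchy G σ I) (v₀ : V) (home : τ → V) (α β : ℝ)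
    (t : MSTTour G (tourNodes H v₀ home α β) v₀) : Schedule G v₀ home where
  objEnd := v₀
  objWalk := t.walk
  site := destination H v₀ home α β
  site_mem T := t.mem_walk (destination_mem H v₀ home α β T)
  txnWalk T := G.shortestWalk (home T) (destination H v₀ home α β T)

end DualFlow

end

/-! Hierarchies: at scale r, take a maximal r-separated set and send every node to one of its points
within r. The fibres have diameter at most 2r, and doubling twice bounds the number of them meeting
an r-ball by 4^δ.

Tour: a closed walk through the required nodes contains, after shortcutting to these nodes, a
spanning tree. Hence the minimum tree weighs at most Tour*, and the doubled tree gives the factor 2.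

Cost: fix any schedule, with object length W and total transaction length X. Before level l is
processed, balls of radius about r_l hold O(Iα/β) unassigned transactions, since a denser cluster
would have qualified one level below. The object's walk meets few such balls, so a level with many
assigned transactions forces the schedule to pay for r_l times their number (`Schedule.card_mul_le`,
`radius_mul_card_le`). The pruning threshold makes the additive error of this bound absorbable.
Summing over the h + 1 levels bounds the moves to super-leaders.

The remaining transactions number O(hIα/β), and each is at distance at most its own walk plus W from
`v₀` (`card_leftovers_le`). For the tour, go along the object's walk and back, with an excursion to
each super-leader from the execution site of its cheapest transaction. At least 2γ transactions
share each excursion, and γ ≥ α/β, so its object cost α is paid at transaction rate β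
(`ceil_mul_optTour_le`). All terms are O(h) times the cost of the schedule, and h = O(log D). -/

noncomputable section

namespace DualFlow

namespace WeightedGraph

variable {V : Type*} (G : WeightedGraph V)

/-! ### The distance is a metric -/

theorem dist_le_walkLength {u v : V} (p : G.graph.Walk u v) : G.dist u v ≤ G.walkLength p :=
  ciInf_le ⟨0, by rintro _ ⟨q, rfl⟩; exact G.walkLength_nonneg q⟩ p

theorem dist_nonneg (u v : V) : 0 ≤ G.dist u v :=
  Real.iInf_nonneg fun p => G.walkLength_nonneg p

theorem walkLength_nil (u : V) : G.walkLength (SimpleGraph.Walk.nil : G.graph.Walk u u) = 0 := by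
  simp [walkLength]

theorem walkLength_cons {u v w : V} (h : G.graph.Adj u v) (p : G.graph.Walk v w) :
    G.walkLength (SimpleGraph.Walk.cons h p) = G.weight s(u, v) + G.walkLength p := by
  simp [walkLength]

theorem walkLength_append {u v w : V} (p : G.graph.Walk u v) (q : G.graph.Walk v w) :
    G.walkLength (p.append q) = G.walkLength p + G.walkLength q := by
  simp [walkLength, SimpleGraph.Walk.edges_append]

theorem walkLength_reverse {u v : V} (p : G.graph.Walk u v) :
    G.walkLength p.reverse = G.walkLength p := by
  simp [walkLength, List.sum_reverse]

theorem dist_self (u : V) : G.dist u u = 0 :=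
  le_antisymm ((G.dist_le_walkLength .nil).trans (G.walkLength_nil u).le) (G.dist_nonneg u u)

theorem dist_le_weight {u v : V} (h : G.graph.Adj u v) : G.dist u v ≤ G.weight s(u, v) := by
  have := G.dist_le_walkLength (SimpleGraph.Walk.cons h .nil)
  rwa [walkLength_cons, walkLength_nil, add_zero] at this

theorem walkLength_shortestWalk [Finite V] (u v : V) :
    G.walkLength (G.shortestWalk u v) = G.dist u v :=
  (G.exists_shortest u v).choose_spec

theorem dist_triangle [Finite V] (u v w : V) : G.dist u w ≤ G.dist u v + G.dist v w := by
  rw [← G.walkLength_shortestWalk u v, ← G.walkLength_shortestWalk v w, ← walkLength_append]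
  exact G.dist_le_walkLength _

theorem dist_le_diam [Finite V] (u v : V) : G.dist u v ≤ G.diam :=
  le_ciSup (f := fun p : V × V => G.dist p.1 p.2) (Set.finite_range _).bddAbove (u, v)

theorem diam_nonneg : 0 ≤ G.diam :=
  Real.iSup_nonneg fun _ => G.dist_nonneg _ _

/-- On a walk, the distance from the start to a visited node is at most the length. -/
theorem dist_le_walkLength_of_mem_support {u v x : V} (p : G.graph.Walk u v)
    (hx : x ∈ p.support) : G.dist u x ≤ G.walkLength p := by
  classical
  have h := congrArg G.walkLength (p.take_spec hx)
  rw [walkLength_append] at h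
  linarith [G.dist_le_walkLength (p.takeUntil x hx), G.walkLength_nonneg (p.dropUntil x hx)]

end WeightedGraph

/-! ### Existence of hierarchies -/

section HierarchyExistence

variable {V : Type*} [Fintype V] (G : WeightedGraph V)

/-- In doubling dimension `δ`, a ball of radius `2 r` contains at most `4 ^ δ` points with mutual
distances larger than `r`. -/
theorem card_separated_le {δ : ℝ} (hG : G.DoublingDimLE δ) {r : ℝ} (hr : 0 ≤ r) (v : V)
    (A : Finset V) (hA : ∀ a ∈ A, G.dist v a ≤ 2 * r)
    (hsep : ∀ a ∈ A, ∀ b ∈ A, a ≠ b → r < G.dist a b) :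
    (#A : ℝ) ≤ (2 : ℝ) ^ δ * (2 : ℝ) ^ δ := by
  classical
  -- Halving twice covers the ball by balls of radius r/2; each contains at most one point of `A`.
  obtain ⟨C, hC, hcov⟩ := hG v (2 * r) (by linarith)
  choose B hB hBcov using fun c => hG c r hr
  have hsub : ∀ a ∈ A, ∃ b ∈ C.biUnion B, G.dist b a ≤ r / 2 := by
    intro a ha
    have h1 := hcov (show a ∈ G.nbhd v (2 * r) from hA a ha)
    simp only [Set.mem_iUnion] at h1
    obtain ⟨c, hc, hac⟩ := h1
    have h2 := hBcov c (show a ∈ G.nbhd c r by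
      have : G.dist c a ≤ 2 * r / 2 := hac
      exact this.trans (by linarith))
    simp only [Set.mem_iUnion] at h2
    obtain ⟨b, hb, hab⟩ := h2
    exact ⟨b, mem_biUnion.2 ⟨c, hc, hb⟩, hab⟩
  choose! f hf hfd using hsub
  have hcard : #A ≤ #(C.biUnion B) := by
    refine card_le_card_of_injOn f hf fun a ha b hb hab => ?_
    by_contra hne
    have h1 := hsep a ha b hb hne
    have h2 := hfd a ha
    have h3 := hfd b hb
    rw [← hab] at h3
    rw [G.dist_comm] at h2
    linarith [G.dist_triangle a (f a) b]
  calc (#A : ℝ) ≤ #(C.biUnion B) := by exact_mod_cast hcard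
    _ ≤ ∑ c ∈ C, (#(B c) : ℝ) := by exact_mod_cast card_biUnion_le
    _ ≤ ∑ _c ∈ C, (2 : ℝ) ^ δ := sum_le_sum fun c _ => hB c
    _ = #C * (2 : ℝ) ^ δ := by rw [sum_const, nsmul_eq_mul]
    _ ≤ _ := by gcongr

/-- A maximal subset with mutual distances larger than `r` is an `r`-net. -/
theorem exists_net {r : ℝ} (hr : 0 ≤ r) :
    ∃ N : Finset V, (∀ a ∈ N, ∀ b ∈ N, a ≠ b → r < G.dist a b) ∧
      ∀ v, ∃ a ∈ N, G.dist a v ≤ r := by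
  classical
  let 𝒩 : Finset (Finset V) :=
    univ.filter fun N => ∀ a ∈ N, ∀ b ∈ N, a ≠ b → r < G.dist a b
  obtain ⟨N, hN, hmax⟩ := exists_max_image 𝒩 card ⟨∅, by simp [𝒩]⟩
  have hsep := (mem_filter.1 hN).2
  refine ⟨N, hsep, fun v => ?_⟩
  by_contra! hv
  have hvN : v ∉ N := fun h => absurd (hv v h) (by rw [G.dist_self]; exact hr.not_gt)
  have hins : insert v N ∈ 𝒩 := by
    refine mem_filter.2 ⟨mem_univ _, fun a ha b hb hab => ?_⟩
    rcases mem_insert.1 ha with rfl | ha' <;> rcases mem_insert.1 hb with rfl | hb'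
    · exact absurd rfl hab
    · rw [G.dist_comm]; exact hv b hb'
    · exact hv a ha'
    · exact hsep a ha' b hb' hab
  have := hmax _ hins
  rw [card_insert_of_notMem hvN] at this
  omega

/-- Clusters are the fibres of a map `c` to net points within r. A cluster meeting the r-ball about
v has its net point within 2r of v, so packing bounds their number. -/
theorem exists_isPartition [DecidableEq V] {δ : ℝ} (hG : G.DoublingDimLE δ) {r : ℝ}
    (hr : 0 ≤ r) :
    ∃ P : Finpartition (univ : Finset V),
      IsPartition G r 2 ⌊(2 : ℝ) ^ δ * (2 : ℝ) ^ δ⌋₊ P := by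
  obtain ⟨N, hsep, hnet⟩ := exists_net G hr
  choose c hcN hc using hnet
  let S : Setoid V := Setoid.ker c
  let : DecidableRel S.r := fun a b => inferInstanceAs (Decidable (c a = c b))
  have hpart : ∀ X ∈ (Finpartition.ofSetoid S).parts, ∀ u ∈ X, ∀ v ∈ X, c u = c v := by
    intro X hX u hu v hv
    have h1 : (Finpartition.ofSetoid S).part u = X := Finpartition.part_eq_of_mem _ hX hu
    rw [← h1] at hv
    exact (Finpartition.mem_part_ofSetoid_iff_rel.1 hv)
  refine ⟨Finpartition.ofSetoid S, fun X hX u hu v hv => ?_, fun v => ?_⟩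
  · have h1 := hc u
    have h2 := hc v
    rw [← hpart X hX u hu v hv] at h2
    rw [G.dist_comm] at h1
    linarith [G.dist_triangle u (c u) v]
  · let A : Finset V := N.filter fun a => G.dist v a ≤ 2 * r
    have hA : #A ≤ ⌊(2 : ℝ) ^ δ * (2 : ℝ) ^ δ⌋₊ := Nat.le_floor
      (card_separated_le G hG hr v A (fun a ha => (mem_filter.1 ha).2)
        fun a ha b hb => hsep a (mem_filter.1 ha).1 b (mem_filter.1 hb).1)
    refine le_trans ?_ hA
    rw [← Set.ncard_coe_finset]
    have hw : ∀ X ∈ {X : Finset V | X ∈ (Finpartition.ofSetoid S).parts ∧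
        ((X : Set V) ∩ G.nbhd v r).Nonempty}, ∃ u ∈ X, G.dist v u ≤ r :=
      fun X hX => hX.2
    have : Nonempty V := ⟨v⟩
    choose! f hf hfd using hw
    refine Set.ncard_le_ncard_of_injOn (fun X => c (f X)) (fun X hX => ?_)
      (fun X hX Y hY hXY => ?_) A.finite_toSet
    · refine mem_coe.2 (mem_filter.2 ⟨hcN _, ?_⟩)
      have h1 := hfd X hX
      have h2 := hc (f X)
      rw [G.dist_comm] at h2
      linarith [G.dist_triangle v (f X) (c (f X))]
    · rw [← Finpartition.part_eq_of_mem _ hX.1 (hf X hX),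
        ← Finpartition.part_eq_of_mem _ hY.1 (hf Y hY)]
      exact Finpartition.part_eq_of_mem _ (Finpartition.part_mem _ |>.2 (mem_univ _))
        (Finpartition.mem_part_ofSetoid_iff_rel.2 hXY.symm)

/-- The levels are independent of each other: no nesting is required. Only the top one is replaced,
by the single cluster `V`, which is admissible because the radius there is D. -/
theorem nonempty_hierarchy [DecidableEq V] {δ : ℝ} (hG : G.DoublingDimLE δ) :
    Nonempty (Hierarchy G 2 ⌊(2 : ℝ) ^ δ * (2 : ℝ) ^ δ⌋₊) := by
  have : Nonempty V := G.connected.nonempty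
  obtain ⟨v₀⟩ := this
  have hD := G.diam_nonneg
  have hr : ∀ l : ℕ, 0 ≤ min G.diam ((4 * 2 : ℝ) ^ l) := fun l => le_min hD (by positivity)
  choose P hP using fun l => exists_isPartition G hG (hr l)
  have hne : (univ : Finset V) ≠ ∅ := univ_nonempty_iff.2 ⟨v₀⟩ |>.ne_empty
  let Q := Finpartition.indiscrete hne
  -- No sign of δ is assumed; packing a single point at radius 0 gives the bound.
  have hI : 1 ≤ ⌊(2 : ℝ) ^ δ * (2 : ℝ) ^ δ⌋₊ := by
    refine Nat.le_floor ?_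
    have := card_separated_le G hG le_rfl v₀ {v₀} (by simp [G.dist_self]) (by simp)
    simpa using this
  refine ⟨⟨fun l => if l = topLevel G 2 then Q else P l, fun l hl => ?_, ?_,
    fun _ X => if hX : X.Nonempty then hX.choose else v₀, fun l _ X hX => ?_⟩⟩
  · split_ifs with h
    · subst h
      have hle : G.diam ≤ (4 * 2 : ℝ) ^ topLevel G 2 := by
        rcases hD.eq_or_lt with h0 | h0
        · rw [← h0]; positivity
        · rw [← Real.rpow_natCast]
          exact (Real.logb_le_iff_le_rpow (by norm_num) h0).1 (Nat.le_ceil _)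
      refine ⟨fun X _ u _ v _ => ?_, fun v => le_trans ?_ hI⟩
      · rw [min_eq_left hle]
        linarith [G.dist_le_diam u v]
      · refine (Set.ncard_le_ncard (t := {univ}) ?_).trans (Set.ncard_singleton _).le
        rintro X ⟨hX, -⟩
        simpa [Q] using hX
    · exact hP l
  · simp [Q]
  · have hX' : X.Nonempty := Finpartition.nonempty_of_mem_parts _ hX
    rw [dif_pos hX']
    exact hX'.choose_spec

end HierarchyExistence

end DualFlow
end

noncomputable section

namespace DualFlow

/-! ### Eulerian circuits of doubled trees -/

/-- The closed walks from `v` in which every edge that occurs does so twice: in a finite connected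
graph, one of them visits all nodes. -/
theorem exists_doubled_circuit_visiting {S : Type*} [Fintype S] [DecidableEq S]
    {T : SimpleGraph S} (hT : T.Connected) (v : S) :
    ∃ c : T.Walk v v, (∀ e ∈ c.edges, c.edges.count e = 2) ∧ ∀ x, x ∈ c.support := by
  suffices h : ∀ n, n ≤ Fintype.card S → ∃ c : T.Walk v v,
      (∀ e ∈ c.edges, c.edges.count e = 2) ∧ n ≤ #c.support.toFinset by
    obtain ⟨c, hc, hn⟩ := h _ le_rfl
    refine ⟨c, hc, fun x => ?_⟩
    have := (card_eq_iff_eq_univ _).1 (le_antisymm (card_le_univ _) hn)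
    exact List.mem_toFinset.1 (this ▸ mem_univ x)
  intro n
  induction n with
  | zero => exact fun _ => ⟨.nil, by simp, Nat.zero_le _⟩
  | succ n ih =>
    intro hn
    obtain ⟨c, hc, hcn⟩ := ih (by omega)
    by_cases hall : ∀ x, x ∈ c.support
    · refine ⟨c, hc, hn.trans ?_⟩
      rw [← card_univ]
      exact card_le_card fun x _ => List.mem_toFinset.2 (hall x)
    push Not at hall
    obtain ⟨z, hz⟩ := hall
    -- An edge xy leaves the visited set. The detour x, y, x uses it twice, and it is new because y
    -- was unvisited.
    obtain ⟨d, -, hx, hy⟩ := (hT v z).some.exists_boundary_dart {x | x ∈ c.support}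
      c.start_mem_support hz
    obtain ⟨⟨x, y⟩, hxy⟩ := d
    change x ∈ c.support at hx
    change y ∉ c.support at hy
    let c' : T.Walk v v := (c.takeUntil x hx).append (.cons hxy (.cons hxy.symm (c.dropUntil x hx)))
    have hperm : c'.edges.Perm (s(x, y) :: s(x, y) :: c.edges) := by
      have h1 : c'.edges = (c.takeUntil x hx).edges ++
          (s(x, y) :: s(x, y) :: (c.dropUntil x hx).edges) := by
        simp [c', SimpleGraph.Walk.edges_append, Sym2.eq_swap (a := y) (b := x)]
      have h2 : c.edges = (c.takeUntil x hx).edges ++ (c.dropUntil x hx).edges := by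
        rw [← SimpleGraph.Walk.edges_append, SimpleGraph.Walk.take_spec]
      rw [h1, h2]
      exact List.perm_middle.trans (List.Perm.cons _ List.perm_middle)
    have hnew : s(x, y) ∉ c.edges := fun h => hy (c.snd_mem_support_of_mem_edges h)
    refine ⟨c', fun e he => ?_, ?_⟩
    · rw [hperm.count_eq]
      by_cases hexy : e = s(x, y)
      · subst hexy
        simp [List.count_eq_zero_of_not_mem hnew]
      · rw [hperm.mem_iff] at he
        simp only [List.mem_cons, hexy, false_or] at he
        rw [List.count_cons_of_ne (Ne.symm hexy), List.count_cons_of_ne (Ne.symm hexy), hc e he]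
    · have hsub : insert y c.support.toFinset ⊆ c'.support.toFinset := by
        intro w hw
        rw [List.mem_toFinset, SimpleGraph.Walk.mem_support_append_iff]
        rcases mem_insert.1 hw with rfl | hw
        · right; simp
        · rw [List.mem_toFinset, ← c.take_spec hx, SimpleGraph.Walk.mem_support_append_iff] at hw
          rcases hw with hw | hw
          · exact Or.inl hw
          · right; simp [hw]
      have h3 := card_le_card hsub
      rw [card_insert_of_notMem (by simpa using hy)] at h3
      omega

/-- The doubled tree has an Eulerian circuit. -/
theorem exists_doubled_circuit {S : Type*} [Fintype S] [DecidableEq S] {T : SimpleGraph S}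
    (hT : T.IsTree) (v : S) :
    ∃ c : T.Walk v v, (∀ e ∈ T.edgeSet, c.edges.count e = 2) ∧ ∀ x, x ∈ c.support := by
  obtain ⟨c, hc, hall⟩ := exists_doubled_circuit_visiting hT.1 v
  refine ⟨c, fun e he => hc e ?_, hall⟩
  -- Tree edges are bridges: a circuit missing one would still connect all nodes after its deletion.
  by_contra hec
  have hbridge := SimpleGraph.isAcyclic_iff_forall_isBridge.1 hT.2 he
  induction e with
  | _ x y =>
    refine SimpleGraph.isBridge_iff.1 hbridge ?_
    let c' : (T.deleteEdges {s(x, y)}).Walk v v := c.transfer _ fun e' he' => by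
      rw [SimpleGraph.edgeSet_deleteEdges]
      exact ⟨c.edges_subset_edgeSet he', fun h => hec (by rwa [← Set.mem_singleton_iff.1 h])⟩
    have hreach : ∀ z, (T.deleteEdges {s(x, y)}).Reachable v z := fun z =>
      ⟨c'.takeUntil z (by simpa [c'] using hall z)⟩
    exact (hreach x).symm.trans (hreach y)

/-! ### Tours from minimum spanning trees -/

namespace WeightedGraph

variable {V : Type*} (G : WeightedGraph V)

/-- The length of the chain `u`, `l`, `t` with respect to the distance. -/
def chainLength (t : V) : V → List V → ℝ
  | u, [] => G.dist u t
  | u, v :: l => G.dist u v + chainLength t v l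

theorem walkLength_walkVia [Finite V] (t : V) :
    ∀ (l : List V) (u : V), G.walkLength (G.walkVia t u l) = G.chainLength t u l
  | [], u => G.walkLength_shortestWalk u t
  | v :: l, u => by
    rw [walkVia, walkLength_append, walkLength_shortestWalk, walkLength_walkVia t l v, chainLength]

theorem chainLength_le_dist_add [Finite V] (t u v : V) :
    ∀ l : List V, G.chainLength t u l ≤ G.dist u v + G.chainLength t v l
  | [] => G.dist_triangle u v t
  | w :: l => by
    simp only [chainLength]
    linarith [G.dist_triangle u v w]

/-- Shortcutting: each skipped node is one use of the triangle inequality. -/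
theorem chainLength_mono [Finite V] (t : V) {l l' : List V} (h : l.Sublist l') :
    ∀ u, G.chainLength t u l ≤ G.chainLength t u l' := by
  induction h with
  | slnil => exact fun u => le_rfl
  | cons v _ ih => exact fun u => (G.chainLength_le_dist_add t u v _).trans (by
      simp only [chainLength]; linarith [ih v])
  | cons_cons v _ ih => exact fun u => by simp only [chainLength]; linarith [ih v]

/-- The distance between the ends of an edge of a graph on `S`. -/
def edgeDist (S : Finset V) (e : Sym2 S) : ℝ :=
  Sym2.lift ⟨fun a b : S => G.dist a b, fun a b => G.dist_comm a b⟩ e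

theorem edgeDist_nonneg (S : Finset V) (e : Sym2 S) : 0 ≤ G.edgeDist S e := by
  induction e with
  | _ x y => exact G.dist_nonneg _ _

theorem chainLength_support {S : Finset V} {T : SimpleGraph S} {u v : S} (p : T.Walk u v) :
    G.chainLength v u (p.support.tail.map Subtype.val) = (p.edges.map (G.edgeDist S)).sum := by
  induction p with
  | nil => simp [chainLength, G.dist_self]
  | cons h p ih =>
    rw [SimpleGraph.Walk.support_cons, List.tail_cons, ← p.cons_tail_support, List.map_cons,
      chainLength, ih]
    simp [edgeDist]

/-- The nodes of `S` on a walk of `G` can be visited in the order of their appearance, by a walk in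
the complete graph on `S` that is not longer. -/
theorem exists_walk_top_of_walk [Finite V] (S : Finset V) {a w : V} (p : G.graph.Walk a w) :
    ∀ u : S, ∃ (v : S) (q : (⊤ : SimpleGraph S).Walk u v),
      (∀ x : S, (x : V) ∈ p.support → x ∈ q.support) ∧
      (q.edges.map (G.edgeDist S)).sum ≤ G.dist u a + G.walkLength p := by
  -- The distance from the last visited node of `S` to the current position is carried as a debt,
  -- settled when the walk next meets `S`.
  have key : ∀ (a : V) (u : S), ∃ (v : S) (q : (⊤ : SimpleGraph S).Walk u v),
      (∀ x : S, (x : V) = a → x ∈ q.support) ∧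
      (q.edges.map (G.edgeDist S)).sum + G.dist v a ≤ G.dist u a := by
    intro a u
    by_cases ha : a ∈ S
    · by_cases hu : u = ⟨a, ha⟩
      · subst hu
        exact ⟨_, .nil, fun x hx => by simp [Subtype.ext_iff, hx], by simp⟩
      · refine ⟨⟨a, ha⟩, .cons ((SimpleGraph.top_adj _ _).2 hu) .nil,
          fun x hx => by simp [Subtype.ext_iff, hx], by simp [edgeDist, G.dist_self]⟩
    · exact ⟨u, .nil, fun x hx => absurd (hx ▸ x.2) ha, by simp⟩
  induction p with
  | nil =>
    intro u
    obtain ⟨v, q, hq, hl⟩ := key _ u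
    refine ⟨v, q, fun x hx => hq x (by simpa using hx), ?_⟩
    rw [walkLength_nil]
    linarith [G.dist_nonneg v ‹V›]
  | @cons a b w h p ih =>
    intro u
    obtain ⟨v, q, hq, hl⟩ := key a u
    obtain ⟨v', q', hq', hl'⟩ := ih v
    refine ⟨v', q.append q', fun x hx => ?_, ?_⟩
    · rw [SimpleGraph.Walk.mem_support_append_iff]
      rw [SimpleGraph.Walk.support_cons, List.mem_cons] at hx
      exact hx.imp (hq x) (hq' x)
    · rw [SimpleGraph.Walk.edges_append, List.map_append, List.sum_append, walkLength_cons]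
      linarith [G.dist_triangle v a b, G.dist_le_weight h]

end WeightedGraph

section MSTLemmas

variable {V : Type*} (G : WeightedGraph V)

open Classical in
theorem metricWeight_eq_sum (S : Finset V) (T : SimpleGraph S) :
    metricWeight G S T = ∑ e ∈ univ.filter (· ∈ T.edgeSet), G.edgeDist S e :=
  (sum_subtype _ (fun e => by simp) (G.edgeDist S)).symm

/-- Every walk in the complete graph on `S` that visits all nodes contains a spanning tree. -/
theorem exists_isTree_metricWeight_le {S : Finset V} {u v : S}
    (q : (⊤ : SimpleGraph S).Walk u v) (hq : ∀ x, x ∈ q.support) :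
    ∃ T : SimpleGraph S, T.IsTree ∧
      metricWeight G S T ≤ (q.edges.map (G.edgeDist S)).sum := by
  classical
  let A : SimpleGraph S := SimpleGraph.fromEdgeSet {e | e ∈ q.edges}
  have hA : ∀ e ∈ q.edges, e ∈ A.edgeSet := fun e he => by
    rw [SimpleGraph.edgeSet_fromEdgeSet]
    exact ⟨he, SimpleGraph.not_isDiag_of_mem_edgeSet _ (q.edges_subset_edgeSet he)⟩
  have hreach : ∀ x, A.Reachable u x := fun x =>
    ⟨(q.transfer A hA).takeUntil x (by simpa using hq x)⟩
  have hconn : A.Connected :=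
    { preconnected := fun x y => (hreach x).symm.trans (hreach y), nonempty := ⟨u⟩ }
  obtain ⟨T, hTA, hT⟩ := hconn.exists_isTree_le
  refine ⟨T, hT, ?_⟩
  have hsub : univ.filter (· ∈ T.edgeSet) ⊆ q.edges.toFinset := fun e he => by
    have := SimpleGraph.edgeSet_mono hTA (mem_filter.1 he).2
    rw [SimpleGraph.edgeSet_fromEdgeSet] at this
    exact List.mem_toFinset.2 this.1
  rw [metricWeight_eq_sum, Finset.sum_list_map_count]
  refine sum_le_sum_of_subset_of_nonneg hsub (fun e _ _ => G.edgeDist_nonneg S e) |>.trans ?_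
  refine sum_le_sum fun e he => ?_
  have h1 : 1 ≤ q.edges.count e := List.count_pos_iff.2 (List.mem_toFinset.1 he)
  rw [nsmul_eq_mul]
  exact le_mul_of_one_le_left (G.edgeDist_nonneg S e) (by exact_mod_cast h1)

variable [DecidableEq V]

theorem nonempty_mstTour {S : Finset V} {v₀ : V} (h : v₀ ∈ S) : Nonempty (MSTTour G S v₀) := by
  classical
  have : Nonempty S := ⟨⟨v₀, h⟩⟩
  obtain ⟨T₀, -, hT₀⟩ := (SimpleGraph.connected_top (V := S)).exists_isTree_le
  have : Nonempty {T : SimpleGraph S // T.IsTree} := ⟨⟨T₀, hT₀⟩⟩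
  obtain ⟨T, hT⟩ :=
    Finite.exists_min fun T : {T : SimpleGraph S // T.IsTree} => metricWeight G S T.1
  obtain ⟨c, hc, hall⟩ := exists_doubled_circuit T.2 ⟨v₀, h⟩
  refine ⟨{
    mem := h
    tree := T.1
    isTree := T.2
    minimal := fun T' hT' => hT ⟨T', hT'⟩
    circuit := c
    twice := fun e he => by convert hc e he
    -- The base point is already the head of the tour, so it is removed from the tail before
    -- deduplication.
    stops := (c.support.tail.filter (· ≠ ⟨v₀, h⟩)).dedup
    shortcut := ?_
    nodup := ?_
    visits := fun x => ?_ }⟩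
  · conv_rhs => rw [← c.cons_tail_support]
    exact ((List.dedup_sublist _).trans List.filter_sublist).cons_cons _
  · refine List.nodup_cons.2 ⟨fun hmem => ?_, List.nodup_dedup _⟩
    simp at hmem
  · have := hall x
    rw [← c.cons_tail_support, List.mem_cons] at this
    by_cases hx : x = ⟨v₀, h⟩
    · exact List.mem_cons.2 (Or.inl hx)
    · refine List.mem_cons.2 (Or.inr (List.mem_dedup.2 (List.mem_filter.2 ⟨?_, by simpa using hx⟩)))
      exact this.resolve_left hx

/-- The circuit of the doubled tree bounds the length of an MST-based tour. -/
theorem MSTTour.walkLength_le_metricWeight [Finite V] {S : Finset V} {v₀ : V}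
    (t : MSTTour G S v₀) : G.walkLength t.walk ≤ 2 * metricWeight G S t.tree := by
  classical
  have hsub : t.stops.Sublist t.circuit.support.tail := by
    have := t.shortcut
    rw [← t.circuit.cons_tail_support] at this
    exact List.cons_sublist_cons.1 this
  rw [MSTTour.walk, G.walkLength_walkVia]
  refine (G.chainLength_mono v₀ (hsub.map _) v₀).trans ?_
  refine (G.chainLength_support t.circuit).le.trans ?_
  rw [Finset.sum_list_map_count, metricWeight_eq_sum, mul_sum]
  refine (sum_le_sum_of_subset_of_nonneg (t := univ.filter (· ∈ t.tree.edgeSet))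
    (fun e he => ?_) (fun e _ _ => ?_)).trans (sum_le_sum fun e he => ?_)
  · exact mem_filter.2 ⟨mem_univ _, t.circuit.edges_subset_edgeSet (List.mem_toFinset.1 he)⟩
  · exact nsmul_nonneg (G.edgeDist_nonneg S e) _
  · have := t.twice e (mem_filter.1 he).2
    rw [nsmul_eq_mul, show t.circuit.edges.count e = 2 by convert this]
    norm_num

/-- Every competing closed walk yields a spanning tree that weighs no more than its length, so
minimality of `t.tree` applies. -/
theorem MSTTour.walkLength_le [Finite V] {S : Finset V} {v₀ : V} (t : MSTTour G S v₀) :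
    G.walkLength t.walk ≤ 2 * optTour G S v₀ := by
  have : Nonempty {p : G.graph.Walk v₀ v₀ // ∀ x ∈ S, x ∈ p.support} :=
    ⟨⟨t.walk, fun x hx => t.mem_walk hx⟩⟩
  refine (t.walkLength_le_metricWeight G).trans ?_
  refine mul_le_mul_of_nonneg_left (le_ciInf fun p => ?_) zero_le_two
  obtain ⟨v, q, hq, hl⟩ := G.exists_walk_top_of_walk S p.1 ⟨v₀, t.mem⟩
  obtain ⟨T, hT, hTw⟩ := exists_isTree_metricWeight_le G q fun x => hq x (p.2 x x.2)
  simp only [G.dist_self, zero_add] at hl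
  exact (t.minimal T hT).trans (hTw.trans hl)

end MSTLemmas

end DualFlow
end

noncomputable section

namespace DualFlow

/-! ### Walks: nets and excursions -/

namespace WeightedGraph

variable {V : Type*} [Finite V] (G : WeightedGraph V)

/-- A walk of length `L` is covered by at most `1 + L / r` balls of radius `r`. -/
theorem exists_net_of_walk {r : ℝ} (hr : 0 ≤ r) {a w : V} (p : G.graph.Walk a w) :
    ∃ C : Finset V, r * (#C : ℝ) ≤ r + G.walkLength p ∧
      ∀ x ∈ p.support, ∃ c ∈ C, G.dist c x ≤ r := by
  classical
  -- Greedy choice: `c₀` is the latest centre, and a new one is opened once the walk is farther than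
  -- r from it. The term `G.dist c₀ a` records the length already spent.
  suffices h : ∀ c₀ : V, ∃ C : Finset V, c₀ ∈ C ∧
      r * (#C : ℝ) ≤ r + G.dist c₀ a + G.walkLength p ∧
      ∀ x ∈ p.support, ∃ c ∈ C, G.dist c x ≤ r by
    obtain ⟨C, -, hC, hcov⟩ := h a
    rw [G.dist_self, add_zero] at hC
    exact ⟨C, hC, hcov⟩
  induction p with
  | @nil a =>
    intro c₀
    rw [walkLength_nil]
    by_cases h : G.dist c₀ a ≤ r
    · exact ⟨{c₀}, by simp, by simpa using G.dist_nonneg c₀ a, by simpa using h⟩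
    · refine ⟨{c₀, a}, by simp, ?_, by simp [G.dist_self, hr]⟩
      have : (#{c₀, a} : ℝ) ≤ 2 := by exact_mod_cast card_le_two
      nlinarith
  | @cons a b w h p ih =>
    intro c₀
    rw [walkLength_cons]
    have hab := G.dist_le_weight h
    by_cases hc : G.dist c₀ a ≤ r
    · obtain ⟨C, h₀, hC, hcov⟩ := ih c₀
      refine ⟨C, h₀, by linarith [G.dist_triangle c₀ a b], fun x hx => ?_⟩
      rcases List.mem_cons.1 (SimpleGraph.Walk.support_cons h p ▸ hx) with rfl | hx
      · exact ⟨c₀, h₀, hc⟩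
      · exact hcov x hx
    · obtain ⟨C, h₀, hC, hcov⟩ := ih a
      refine ⟨insert c₀ C, mem_insert_self _ _, ?_, fun x hx => ?_⟩
      · have : (#(insert c₀ C) : ℝ) ≤ #C + 1 := by exact_mod_cast card_insert_le _ _
        nlinarith
      · rcases List.mem_cons.1 (SimpleGraph.Walk.support_cons h p ▸ hx) with rfl | hx
        · exact ⟨x, mem_insert_of_mem h₀, by rwa [G.dist_self]⟩
        · obtain ⟨c, hc, hcx⟩ := hcov x hx
          exact ⟨c, mem_insert_of_mem hc, hcx⟩

/-- A closed walk can be extended by excursions to further nodes. -/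
theorem exists_walk_with_excursions {ι : Type*} {v₀ : V} (p : G.graph.Walk v₀ v₀) (F : Finset ι)
    (x : ι → V) (e : ι → ℝ) (h : ∀ i ∈ F, ∃ y ∈ p.support, G.dist y (x i) ≤ e i) :
    ∃ q : G.graph.Walk v₀ v₀, (∀ y ∈ p.support, y ∈ q.support) ∧ (∀ i ∈ F, x i ∈ q.support) ∧
      G.walkLength q ≤ G.walkLength p + 2 * ∑ i ∈ F, e i := by
  classical
  induction F using Finset.induction_on with
  | empty => exact ⟨p, fun _ hy => hy, by simp, by simp⟩
  | insert i F hi ih =>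
    obtain ⟨q, hpq, hF, hq⟩ := ih fun j hj => h j (mem_insert_of_mem hj)
    obtain ⟨y, hy, hyi⟩ := h i (mem_insert_self _ _)
    let s := G.shortestWalk y (x i)
    let q' : G.graph.Walk v₀ v₀ :=
      (q.takeUntil y (hpq y hy)).append ((s.append s.reverse).append (q.dropUntil y (hpq y hy)))
    have hqq' : ∀ z ∈ q.support, z ∈ q'.support := fun z hz => by
      rw [← q.take_spec (hpq y hy), SimpleGraph.Walk.mem_support_append_iff] at hz
      simp only [q', SimpleGraph.Walk.mem_support_append_iff]
      tauto
    refine ⟨q', fun z hz => hqq' z (hpq z hz), fun j hj => ?_, ?_⟩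
    · rcases mem_insert.1 hj with rfl | hj
      · simp only [q', SimpleGraph.Walk.mem_support_append_iff]
        exact Or.inr (Or.inl (Or.inl s.end_mem_support))
      · exact hqq' _ (hF j hj)
    · have h1 : G.walkLength q' = G.walkLength q + 2 * G.dist y (x i) := by
        have h2 := congrArg G.walkLength (q.take_spec (hpq y hy))
        rw [walkLength_append] at h2
        simp only [q', walkLength_append, walkLength_reverse, s, walkLength_shortestWalk]
        linarith
      rw [sum_insert hi]
      linarith

end WeightedGraph

/-! ### Lower bounds on the cost of a schedule -/

section LowerBound

variable {V τ : Type*} {G : WeightedGraph V} {v₀ : V} {home : τ → V}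

/-- The total length of the transaction walks. -/
def Schedule.txnLength [Fintype τ] (s : Schedule G v₀ home) : ℝ :=
  ∑ T, G.walkLength (s.txnWalk T)

/-- Transactions of which at most `M` live in each ball of radius `r` must travel, or make the
object travel. -/
theorem Schedule.card_mul_le [Finite V] [Fintype τ] (s : Schedule G v₀ home) (U : Finset τ)
    {r : ℝ} {M : ℕ} (hr : 0 < r) (hM : ∀ v, #{T ∈ U | G.dist v (home T) ≤ r} ≤ M) :
    r * #U ≤ M * (r + 2 * G.walkLength s.objWalk) + 2 * s.txnLength := by
  classical
  -- Radius r/2, because a transaction travelling at most r/2 then has its home within r of a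
  -- centre; every other one pays r/2 itself.
  obtain ⟨C, hC, hcov⟩ := G.exists_net_of_walk (half_pos hr).le s.objWalk
  let near := {T ∈ U | G.walkLength (s.txnWalk T) ≤ r / 2}
  let far := {T ∈ U | ¬ G.walkLength (s.txnWalk T) ≤ r / 2}
  have hU : #U = #near + #far := (card_filter_add_card_filter_not _).symm
  have hnear : #near ≤ #C * M := by
    have hsub : near ⊆ C.biUnion fun c => {T ∈ U | G.dist c (home T) ≤ r} := by
      intro T hT
      obtain ⟨hTU, hTr⟩ := mem_filter.1 hT
      obtain ⟨c, hc, hcx⟩ := hcov _ (s.site_mem T)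
      refine mem_biUnion.2 ⟨c, hc, mem_filter.2 ⟨hTU, ?_⟩⟩
      have h1 := G.dist_le_walkLength (s.txnWalk T)
      rw [G.dist_comm] at h1
      linarith [G.dist_triangle c (s.site T) (home T)]
    exact (card_le_card hsub).trans (card_biUnion_le_card_mul _ _ _ fun c _ => hM c)
  have hfar : r / 2 * #far ≤ s.txnLength := by
    calc r / 2 * #far = ∑ _T ∈ far, r / 2 := by rw [sum_const, nsmul_eq_mul, mul_comm]
      _ ≤ ∑ T ∈ far, G.walkLength (s.txnWalk T) :=
        sum_le_sum fun T hT => (not_le.1 (mem_filter.1 hT).2).le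
      _ ≤ s.txnLength :=
        sum_le_univ_sum_of_nonneg fun T => G.walkLength_nonneg _
  have hnear' : (#near : ℝ) ≤ #C * M := by exact_mod_cast hnear
  have hMC : r * (#C * M) ≤ M * (r + 2 * G.walkLength s.objWalk) := by
    nlinarith [(Nat.cast_nonneg M : (0 : ℝ) ≤ M)]
  rw [hU, Nat.cast_add]
  nlinarith

theorem Schedule.dist_home_le [Finite V] (s : Schedule G v₀ home) (T : τ) :
    G.dist (home T) v₀ ≤ G.walkLength (s.txnWalk T) + G.walkLength s.objWalk := by
  have h1 := G.dist_le_walkLength_of_mem_support s.objWalk (s.site_mem T)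
  rw [G.dist_comm] at h1
  linarith [G.dist_triangle (home T) (s.site T) v₀, G.dist_le_walkLength (s.txnWalk T)]

theorem Schedule.cost_nonneg [Fintype τ] {α β : ℝ} (hα : 0 ≤ α) (hβ : 0 ≤ β) (s : Schedule G v₀ home) :
    0 ≤ s.cost α β :=
  add_nonneg (mul_nonneg hα (G.walkLength_nonneg _))
    (mul_nonneg hβ (sum_nonneg fun _ _ => G.walkLength_nonneg _))

end LowerBound

/-! ### Levels of a hierarchy -/

section Levels

variable {V τ : Type*} [Fintype V] [DecidableEq V] {G : WeightedGraph V} {σ : ℝ} {I : ℕ}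
  (H : Hierarchy G σ I) (home : τ → V)

/-- The radius `r_l = min D (ρ ^ l)`. -/
def radius (G : WeightedGraph V) (σ : ℝ) (l : ℕ) : ℝ := min G.diam ((4 * σ) ^ l)

theorem dist_leaderOf_le {l : ℕ} (hl : l ≤ topLevel G σ) (T : τ) :
    G.dist (home T) (leaderOf H home l T) ≤ radius G σ l * σ := by
  have hX : (H.part l).part (home T) ∈ (H.part l).parts :=
    (Finpartition.part_mem _).2 (mem_univ _)
  exact (H.isPartition l hl).1 _ hX _ (Finpartition.mem_part _ (mem_univ _)) _
    (H.leader_mem l hl _ hX)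

theorem Hierarchy.one_le {V : Type*} [Fintype V] [DecidableEq V] {G : WeightedGraph V} {σ : ℝ}
    {I : ℕ} (H : Hierarchy G σ I) : 1 ≤ I := by
  have : Nonempty V := G.connected.nonempty
  obtain ⟨v⟩ := this
  have h := (H.isPartition 0 (Nat.zero_le _)).2 v
  refine le_trans ?_ h
  rw [Nat.one_le_iff_ne_zero, ← Nat.pos_iff_ne_zero, Set.ncard_pos]
  refine ⟨(H.part 0).part v, (Finpartition.part_mem _).2 (mem_univ _), v,
    Finpartition.mem_part _ (mem_univ _), ?_⟩
  change G.dist v v ≤ _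
  rw [G.dist_self]
  exact le_min G.diam_nonneg (by simp)

end Levels

/-! ### Analysis of the algorithm -/

section Analysis

variable {V τ : Type*} [Fintype V] [DecidableEq V] [Fintype τ]
  {G : WeightedGraph V} {σ : ℝ} {I : ℕ} (H : Hierarchy G σ I) (v₀ : V) (home : τ → V) (α β : ℝ)

/-- Index l + 1 means after level l. If 2γ were left in `X`, then `X` would have qualified at level
l and none would be left. -/
theorem unassigned_succ_card_lt (hab : 0 < α / β) (l : ℕ) {X : Finset V}
    (hX : X ∈ (H.part l).parts) :
    #(txnsIn home (unassigned H home α β (l + 1)) X) < 2 * ⌈α / β⌉₊ := by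
  classical
  by_contra! hge
  have hpos : 0 < ⌈α / β⌉₊ := Nat.ceil_pos.2 hab
  obtain ⟨T, hT⟩ := card_pos.1 (lt_of_lt_of_le (by omega) hge)
  obtain ⟨hTu, hTX⟩ := mem_filter.1 hT
  refine (mem_filter.1 hTu).2 ?_
  rw [Finpartition.part_eq_of_mem _ hX hTX]
  exact hge.trans (card_le_card (filter_subset_filter _ (filter_subset _ _)))

theorem assignedAt_or_unassigned (T : τ) (n : ℕ) :
    (∃ l < n, T ∈ assignedAt H home α β l) ∨ T ∈ unassigned H home α β n := by
  classical
  induction n with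
  | zero => exact Or.inr (mem_univ T)
  | succ n ih =>
    rcases ih with ⟨l, hl, hT⟩ | hT
    · exact Or.inl ⟨l, by omega, hT⟩
    · by_cases hq : Qualifies home α β (unassigned H home α β n) ((H.part n).part (home T))
      · exact Or.inl ⟨n, by omega, mem_filter.2 ⟨hT, hq⟩⟩
      · exact Or.inr (mem_filter.2 ⟨hT, hq⟩)

/-- A ball whose radius is that of a level contains few of the transactions that this level leaves
unassigned. -/
theorem card_ball_unassigned_succ_le (hab : 0 < α / β) {l : ℕ} (hl : l ≤ topLevel G σ) (v : V) :
    #{T ∈ unassigned H home α β (l + 1) | G.dist v (home T) ≤ radius G σ l} ≤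
      I * (2 * ⌈α / β⌉₊) := by
  classical
  let 𝒳 : Finset (Finset V) :=
    {X ∈ (H.part l).parts | ((X : Set V) ∩ G.nbhd v (radius G σ l)).Nonempty}
  have h𝒳 : #𝒳 ≤ I := by
    have h := (H.isPartition l hl).2 v
    rw [← Set.ncard_coe_finset]
    convert h using 2
    ext X
    rw [mem_coe, mem_filter]
    rfl
  have hsub : {T ∈ unassigned H home α β (l + 1) | G.dist v (home T) ≤ radius G σ l} ⊆
      𝒳.biUnion fun X => txnsIn home (unassigned H home α β (l + 1)) X := by
    intro T hT
    obtain ⟨hTu, hTv⟩ := mem_filter.1 hT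
    have hmem : home T ∈ (H.part l).part (home T) := Finpartition.mem_part _ (mem_univ _)
    exact mem_biUnion.2 ⟨(H.part l).part (home T), mem_filter.2
      ⟨(Finpartition.part_mem _).2 (mem_univ _), home T, hmem, hTv⟩, mem_filter.2 ⟨hTu, hmem⟩⟩
  refine (card_le_card hsub).trans ((card_biUnion_le_card_mul _ _ (2 * ⌈α / β⌉₊)
    fun X hX => ?_).trans (Nat.mul_le_mul_right _ h𝒳))
  exact (unassigned_succ_card_lt H home α β hab l (mem_filter.1 hX).1).le

/-- At each level there is a radius, comparable to that of the level, for which balls contain few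
of the unassigned transactions. -/
theorem exists_radius_card_ball_le (hσ : 1 ≤ σ) (hsep : ∀ u v : V, u ≠ v → 1 ≤ G.dist u v)
    (hD : 2 ≤ G.diam) (hinj : Function.Injective home) (hab : 0 < α / β) {l : ℕ}
    (hl : l ≤ topLevel G σ) :
    ∃ r, 0 < r ∧ radius G σ l ≤ 4 * σ * r ∧
      ∀ v, #{T ∈ unassigned H home α β l | G.dist v (home T) ≤ r} ≤ I * (2 * ⌈α / β⌉₊) := by
  classical
  cases l with
  | zero =>
    -- Level 0 has no predecessor; a ball of radius 1/2 holds one node, hence at most one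
    -- transaction.
    refine ⟨1 / 2, by norm_num, (min_le_right _ _).trans (by rw [pow_zero]; linarith),
      fun v => ?_⟩
    have h1 : 1 ≤ I * (2 * ⌈α / β⌉₊) :=
      Nat.one_le_iff_ne_zero.2 (by have := H.one_le; have := Nat.ceil_pos.2 hab; positivity)
    refine le_trans (card_le_one.2 fun T hT T' hT' => hinj ?_) h1
    have h2 : ∀ T ∈ ({T ∈ unassigned H home α β 0 | G.dist v (home T) ≤ 1 / 2} : Finset τ),
        v = home T := fun T hT => by
      by_contra hne
      linarith [hsep _ _ hne, (mem_filter.1 hT).2]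
    rw [← h2 T hT, ← h2 T' hT']
  | succ l =>
    have h4 : 1 ≤ 4 * σ := by linarith
    refine ⟨radius G σ l, lt_min (by linarith) (by positivity), ?_,
      card_ball_unassigned_succ_le H home α β hab (by omega)⟩
    rcases le_total G.diam ((4 * σ) ^ l) with h | h
    · rw [radius, radius, min_eq_left h]
      exact (min_le_left _ _).trans (le_mul_of_one_le_left (by linarith) h4)
    · rw [radius, radius, min_eq_right h]
      exact (min_le_right _ _).trans (by rw [pow_succ, mul_comm])

/-! ### Charging the surviving levels -/

/-- The transactions of a level that survives the pruning can be charged to any schedule. -/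
theorem radius_mul_card_le (hσ : 1 ≤ σ) (hsep : ∀ u v : V, u ≠ v → 1 ≤ G.dist u v)
    (hD : 2 ≤ G.diam) (hinj : Function.Injective home) (hβ : 0 < β) (hαβ : β < α) {l : ℕ}
    (hl : l ∈ keptLevels H home α β) (s : Schedule G v₀ home) :
    β * (radius G σ l * #(assignedAt H home α β l)) ≤ 64 * σ * I * s.cost α β := by
  classical
  obtain ⟨hl', hcard⟩ := mem_filter.1 hl
  have hab : 1 < α / β := (one_lt_div hβ).2 hαβ
  obtain ⟨r, hr, hrl, hM⟩ := exists_radius_card_ball_le H home α β hσ hsep hD hinj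
    (by linarith) (Nat.lt_succ_iff.1 (mem_range.1 hl'))
  set A := assignedAt H home α β l
  have h1 := s.card_mul_le A hr (M := I * (2 * ⌈α / β⌉₊)) fun v =>
    (card_le_card (filter_subset_filter _ (filter_subset _ _))).trans (hM v)
  have hceil : (⌈α / β⌉₊ : ℝ) ≤ 2 * (α / β) := by
    linarith [Nat.ceil_lt_add_one (show 0 ≤ α / β by linarith)]
  have hI : (1 : ℝ) ≤ I := by exact_mod_cast H.one_le
  have hM' : ((I * (2 * ⌈α / β⌉₊) : ℕ) : ℝ) ≤ 4 * I * (α / β) := by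
    push_cast
    nlinarith
  have hW := G.walkLength_nonneg s.objWalk
  have hX : 0 ≤ s.txnLength := sum_nonneg fun T _ => G.walkLength_nonneg _
  -- Here the pruning acts: #A ≥ 8Iα/β makes the additive term M·r at most half of r·#A, so it moves
  -- to the left side.
  have h2 : r * #A ≤ 16 * I * (α / β) * G.walkLength s.objWalk + 4 * s.txnLength := by
    have h3 := mul_le_mul_of_nonneg_right hM'
      (show 0 ≤ r + 2 * G.walkLength s.objWalk by linarith)
    have h4 := mul_le_mul_of_nonneg_left hcard hr.le
    linarith
  have h5 : β * (r * #A) ≤ 16 * I * s.cost α β := by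
    have h6 := mul_le_mul_of_nonneg_left h2 hβ.le
    have h7 : β * (16 * I * (α / β) * G.walkLength s.objWalk + 4 * s.txnLength) =
        16 * I * (α * G.walkLength s.objWalk) + 4 * (β * s.txnLength) := by
      field_simp
    have h8 : s.cost α β = α * G.walkLength s.objWalk + β * s.txnLength := rfl
    have h9 : 0 ≤ β * s.txnLength := by positivity
    rw [h8]
    nlinarith
  have h10 : β * (radius G σ l * #A) ≤ 4 * σ * (β * (r * #A)) := by
    have := mul_le_mul_of_nonneg_right hrl (show (0 : ℝ) ≤ β * #A by positivity)
    linarith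
  nlinarith

/-- The total diameter bound of the clusters of the assigned transactions at the surviving
levels. -/
def totalRadius : ℝ :=
  ∑ l ∈ keptLevels H home α β, ∑ _T ∈ assignedAt H home α β l, radius G σ l * σ

theorem card_keptLevels_le : (#(keptLevels H home α β) : ℝ) ≤ topLevel G σ + 1 := by
  classical
  have := card_filter_le (range (topLevel G σ + 1))
    fun l => 8 * (I : ℝ) * (α / β) ≤ (#(assignedAt H home α β l) : ℝ)
  rw [card_range] at this
  have h : #(keptLevels H home α β) ≤ topLevel G σ + 1 := this
  exact_mod_cast h

theorem totalRadius_le (hσ : 1 ≤ σ) (hsep : ∀ u v : V, u ≠ v → 1 ≤ G.dist u v)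
    (hD : 2 ≤ G.diam) (hinj : Function.Injective home) (hβ : 0 < β) (hαβ : β < α)
    (s : Schedule G v₀ home) :
    β * totalRadius H home α β ≤ (topLevel G σ + 1) * (64 * σ ^ 2 * I * s.cost α β) := by
  have hC := s.cost_nonneg (hβ.trans hαβ).le hβ.le
  calc β * totalRadius H home α β
      = ∑ l ∈ keptLevels H home α β, σ * (β * (radius G σ l * #(assignedAt H home α β l))) := by
        rw [totalRadius, mul_sum]
        refine sum_congr rfl fun l _ => ?_
        rw [sum_const, nsmul_eq_mul]
        ring
    _ ≤ ∑ _l ∈ keptLevels H home α β, 64 * σ ^ 2 * I * s.cost α β := by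
        refine sum_le_sum fun l hl => ?_
        have := mul_le_mul_of_nonneg_left
          (radius_mul_card_le H v₀ home α β hσ hsep hD hinj hβ hαβ hl s) (by linarith : 0 ≤ σ)
        linarith
    _ = #(keptLevels H home α β) * (64 * σ ^ 2 * I * s.cost α β) := by
        rw [sum_const, nsmul_eq_mul]
    _ ≤ _ := mul_le_mul_of_nonneg_right (card_keptLevels_le H home α β) (by positivity)

/-! ### Transactions sent to `v₀` -/

open Classical in
/-- The transactions that are moved to `v₀`. -/
def leftovers : Finset τ :=
  univ.filter fun T => ¬ ∃ l ∈ keptLevels H home α β, T ∈ assignedAt H home α β l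

theorem mem_leftovers {T : τ} : T ∈ leftovers H home α β ↔
    ¬ ∃ l ∈ keptLevels H home α β, T ∈ assignedAt H home α β l := by
  classical
  simp only [leftovers, mem_filter, mem_univ, true_and]

/-- Each pruned level contributes less than the threshold. The extra unit in h + 2 pays for the
fewer than 2γ transactions left by the single top cluster. -/
theorem card_leftovers_le (hβ : 0 < β) (hαβ : β < α) :
    (#(leftovers H home α β) : ℝ) ≤ (topLevel G σ + 2) * (8 * I * (α / β)) := by
  classical
  have hab : 1 < α / β := (one_lt_div hβ).2 hαβ
  have hceil : (⌈α / β⌉₊ : ℝ) ≤ 2 * (α / β) := by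
    linarith [Nat.ceil_lt_add_one (show 0 ≤ α / β by linarith)]
  have hI : (1 : ℝ) ≤ I := by exact_mod_cast H.one_le
  let U := unassigned H home α β (topLevel G σ + 1)
  let D := (range (topLevel G σ + 1)).filter fun l => l ∉ keptLevels H home α β
  have hsub : leftovers H home α β ⊆ (D.biUnion fun l => assignedAt H home α β l) ∪ U := by
    intro T hT
    have hT' := (mem_leftovers H home α β).1 hT
    rcases assignedAt_or_unassigned H home α β T (topLevel G σ + 1) with ⟨l, hl, hTl⟩ | hTU
    · exact mem_union_left _ (mem_biUnion.2 ⟨l, mem_filter.2 ⟨mem_range.2 hl,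
        fun hk => hT' ⟨l, hk, hTl⟩⟩, hTl⟩)
    · exact mem_union_right _ hTU
  have hU : (#U : ℝ) ≤ 8 * I * (α / β) := by
    have h1 := unassigned_succ_card_lt H home α β (by linarith) (topLevel G σ)
      (X := univ) (by rw [H.top]; exact mem_singleton_self _)
    have h2 : txnsIn home U univ = U := by simp [txnsIn]
    rw [h2] at h1
    have h3 : (#U : ℝ) ≤ 2 * ⌈α / β⌉₊ := by exact_mod_cast h1.le
    nlinarith
  have hDsum : ((#(D.biUnion fun l => assignedAt H home α β l) : ℕ) : ℝ) ≤
      (topLevel G σ + 1) * (8 * I * (α / β)) := by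
    calc ((#(D.biUnion fun l => assignedAt H home α β l) : ℕ) : ℝ)
        ≤ ∑ l ∈ D, (#(assignedAt H home α β l) : ℝ) := by exact_mod_cast card_biUnion_le
      _ ≤ ∑ _l ∈ D, 8 * I * (α / β) := by
        refine sum_le_sum fun l hl => ?_
        obtain ⟨h1, h2⟩ := mem_filter.1 hl
        by_contra! h3
        exact h2 (mem_filter.2 ⟨h1, h3.le⟩)
      _ = #D * (8 * I * (α / β)) := by rw [sum_const, nsmul_eq_mul]
      _ ≤ _ := by
        refine mul_le_mul_of_nonneg_right ?_ (by positivity)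
        have := card_filter_le (range (topLevel G σ + 1)) fun l => l ∉ keptLevels H home α β
        rw [card_range] at this
        exact_mod_cast this
  have h4 : (#(leftovers H home α β) : ℝ) ≤
      #(D.biUnion fun l => assignedAt H home α β l) + #U := by
    exact_mod_cast (card_le_card hsub).trans (card_union_le _ _)
  linarith

/-- The total distance of the transactions from their destinations. -/
theorem sum_dist_destination_le (hD : 2 ≤ G.diam) (hσ : 1 ≤ σ) (s : Schedule G v₀ home) :
    ∑ T, G.dist (home T) (destination H v₀ home α β T) ≤
      totalRadius H home α β + s.txnLength +
        #(leftovers H home α β) * G.walkLength s.objWalk := by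
  classical
  have hrad : ∀ l, 0 ≤ radius G σ l * σ := fun l =>
    mul_nonneg (le_min (by linarith) (by positivity)) (by linarith)
  -- Summing over all kept levels dominates whichever level `destination` picks.
  have hpt : ∀ T, G.dist (home T) (destination H v₀ home α β T) ≤
      (∑ l ∈ keptLevels H home α β, if T ∈ assignedAt H home α β l then radius G σ l * σ else 0) +
        G.walkLength (s.txnWalk T) +
        if T ∈ leftovers H home α β then G.walkLength s.objWalk else 0 := by
    intro T
    have hnn : ∀ l ∈ keptLevels H home α β,
        0 ≤ if T ∈ assignedAt H home α β l then radius G σ l * σ else 0 := fun l _ => by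
      split_ifs
      exacts [hrad l, le_rfl]
    have hw := G.walkLength_nonneg (s.txnWalk T)
    by_cases hT : ∃ l ∈ keptLevels H home α β, T ∈ assignedAt H home α β l
    · rw [destination, dif_pos hT, if_neg fun h => (mem_leftovers H home α β).1 h hT]
      obtain ⟨h1, h2⟩ := hT.choose_spec
      have h3 := dist_leaderOf_le H home
        (Nat.lt_succ_iff.1 (mem_range.1 (mem_filter.1 h1).1)) T
      have h4 := single_le_sum hnn h1
      rw [if_pos h2] at h4
      linarith
    · rw [destination, dif_neg hT, if_pos ((mem_leftovers H home α β).2 hT)]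
      linarith [s.dist_home_le T, sum_nonneg hnn]
  refine (sum_le_sum fun T _ => hpt T).trans (le_of_eq ?_)
  rw [sum_add_distrib, sum_add_distrib, sum_comm, totalRadius, Schedule.txnLength]
  congr 1
  · congr 1
    refine sum_congr rfl fun l _ => ?_
    rw [← sum_filter, filter_mem_eq_inter, univ_inter]
  · rw [← sum_filter, filter_mem_eq_inter, univ_inter, sum_const, nsmul_eq_mul]

/-! ### Tour length and total cost -/

/-- The clusters whose leaders become super-leaders at level `l`. -/
def superClusters (l : ℕ) : Finset (Finset V) :=
  (assignedAt H home α β l).image fun T => (H.part l).part (home T)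

theorem two_mul_ceil_le_card {l : ℕ} {X : Finset V} (hX : X ∈ superClusters H home α β l) :
    2 * ⌈α / β⌉₊ ≤
      #((assignedAt H home α β l).filter fun T => (H.part l).part (home T) = X) := by
  classical
  obtain ⟨T, hT, rfl⟩ := mem_image.1 hX
  obtain ⟨-, hq⟩ := mem_filter.1 hT
  refine hq.trans (card_le_card fun T' hT' => ?_)
  obtain ⟨h1, h2⟩ := mem_filter.1 hT'
  have h3 := Finpartition.part_eq_of_mem _ ((Finpartition.part_mem _).2 (mem_univ _)) h2
  exact mem_filter.2 ⟨mem_filter.2 ⟨h1, by rwa [h3]⟩, h3⟩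

/-- The optimal tour compared with any schedule: go to and fro along the walk of the object, with
excursions to the super-leaders. -/
theorem ceil_mul_optTour_le (hab : 0 < α / β) (s : Schedule G v₀ home) :
    ⌈α / β⌉₊ * optTour G (tourNodes H v₀ home α β) v₀ ≤
      2 * ⌈α / β⌉₊ * G.walkLength s.objWalk +
        (totalRadius H home α β + (topLevel G σ + 1) * s.txnLength) := by
  classical
  set γ := ⌈α / β⌉₊
  have hγ : (0 : ℝ) < γ := by exact_mod_cast Nat.ceil_pos.2 hab
  let p := s.objWalk.append s.objWalk.reverse
  let F := (keptLevels H home α β).sigma fun l => superClusters H home α β l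
  let c : ℕ → τ → ℝ := fun l T => radius G σ l * σ + G.walkLength (s.txnWalk T)
  let fib : ℕ → Finset V → Finset τ := fun l X =>
    (assignedAt H home α β l).filter fun T => (H.part l).part (home T) = X
  -- At least 2γ transactions lie in the fibre, so the cheapest detour is at most this; the 2
  -- cancels the return trip.
  let e : (Σ _ : ℕ, Finset V) → ℝ := fun i => (∑ T ∈ fib i.1 i.2, c i.1 T) / (2 * γ)
  obtain ⟨q, hpq, hF, hq⟩ := G.exists_walk_with_excursions p F (fun i => H.leader i.1 i.2) e (by
    rintro ⟨l, X⟩ hi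
    obtain ⟨hl, hX⟩ := mem_sigma.1 hi
    change l ∈ keptLevels H home α β at hl
    change X ∈ superClusters H home α β l at hX
    have hl' := Nat.lt_succ_iff.1 (mem_range.1 (mem_filter.1 hl).1)
    have hcard : 2 * (γ : ℝ) ≤ #(fib l X) := by
      exact_mod_cast two_mul_ceil_le_card H home α β hX
    have hne : (fib l X).Nonempty := card_pos.1 (by
      have : (0 : ℝ) < #(fib l X) := by linarith
      exact_mod_cast this)
    obtain ⟨T, hT, hmin⟩ := exists_min_image (fib l X) (c l) hne
    have hTX : (H.part l).part (home T) = X := (mem_filter.1 hT).2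
    have h1 := dist_leaderOf_le H home hl' T
    have h2 := G.dist_le_walkLength (s.txnWalk T)
    have hc : G.dist (s.site T) (H.leader l X) ≤ c l T := by
      rw [G.dist_comm] at h2
      rw [leaderOf, hTX] at h1
      have := G.dist_triangle (s.site T) (home T) (H.leader l X)
      simp only [c]
      linarith
    refine ⟨s.site T, ?_, hc.trans ?_⟩
    · rw [SimpleGraph.Walk.mem_support_append_iff]
      exact Or.inl (s.site_mem T)
    · simp only [e]
      rw [le_div_iff₀ (by positivity)]
      have h3 := card_nsmul_le_sum (fib l X) (c l) (c l T) fun T' hT' => hmin T' hT'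
      rw [nsmul_eq_mul] at h3
      have h4 : 0 ≤ c l T := (G.dist_nonneg _ _).trans hc
      nlinarith)
  have hvis : ∀ x ∈ tourNodes H v₀ home α β, x ∈ q.support := by
    intro x hx
    rcases mem_insert.1 hx with rfl | hx
    · exact q.start_mem_support
    · obtain ⟨l, hl, hx⟩ := mem_biUnion.1 hx
      obtain ⟨T, hT, rfl⟩ := mem_image.1 hx
      exact hF ⟨l, (H.part l).part (home T)⟩ (mem_sigma.2 ⟨hl, mem_image_of_mem _ hT⟩)
  have hopt : optTour G (tourNodes H v₀ home α β) v₀ ≤ G.walkLength q :=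
    ciInf_le (f := fun p : {p : G.graph.Walk v₀ v₀ // ∀ x ∈ tourNodes H v₀ home α β,
      x ∈ p.support} => G.walkLength p.1)
      ⟨0, by rintro _ ⟨q, rfl⟩; exact G.walkLength_nonneg _⟩ ⟨q, hvis⟩
  have hp : G.walkLength p = 2 * G.walkLength s.objWalk := by
    rw [G.walkLength_append, G.walkLength_reverse]
    ring
  have hsum : 2 * γ * ∑ i ∈ F, e i =
      ∑ l ∈ keptLevels H home α β, ∑ T ∈ assignedAt H home α β l, c l T := by
    rw [sum_sigma, mul_sum]
    refine sum_congr rfl fun l _ => ?_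
    simp only [e]
    rw [← sum_div, mul_div_cancel₀ _ (by positivity)]
    exact sum_fiberwise_of_maps_to (fun T hT => mem_image_of_mem _ hT) _
  have hsum' : ∑ l ∈ keptLevels H home α β, ∑ T ∈ assignedAt H home α β l, c l T ≤
      totalRadius H home α β + (topLevel G σ + 1) * s.txnLength := by
    have hX : 0 ≤ s.txnLength := sum_nonneg fun T _ => G.walkLength_nonneg _
    calc ∑ l ∈ keptLevels H home α β, ∑ T ∈ assignedAt H home α β l, c l T
        = totalRadius H home α β + ∑ l ∈ keptLevels H home α β,
            ∑ T ∈ assignedAt H home α β l, G.walkLength (s.txnWalk T) := by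
          simp only [c, sum_add_distrib, totalRadius]
      -- Crude: all transaction walks are counted at every level, which costs only the factor h + 1.
      _ ≤ totalRadius H home α β + ∑ _l ∈ keptLevels H home α β, s.txnLength := by
          gcongr with l
          exact sum_le_univ_sum_of_nonneg fun T => G.walkLength_nonneg _
      _ ≤ _ := by
          rw [sum_const, nsmul_eq_mul]
          gcongr
          exact card_keptLevels_le H home α β
  have h5 := mul_le_mul_of_nonneg_left (hopt.trans hq) hγ.le
  rw [hp] at h5
  linarith

/-- The cost of the algorithm compared with any schedule. -/
theorem cost_globalAwareSingleObj_le (hσ : 1 ≤ σ) (hsep : ∀ u v : V, u ≠ v → 1 ≤ G.dist u v)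
    (hD : 2 ≤ G.diam) (hinj : Function.Injective home) (hβ : 0 < β) (hαβ : β < α)
    (t : MSTTour G (tourNodes H v₀ home α β) v₀) (s : Schedule G v₀ home) :
    (globalAwareSingleObj H v₀ home α β t).cost α β ≤
      (topLevel G σ + 2) * (192 * σ ^ 2 * I + 8 * I + 7) * s.cost α β := by
  have hα : 0 < α := hβ.trans hαβ
  have hab : 1 < α / β := (one_lt_div hβ).2 hαβ
  have hI : (1 : ℝ) ≤ I := by exact_mod_cast H.one_le
  have hB := totalRadius_le H v₀ home α β hσ hsep hD hinj hβ hαβ s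
  have htx := sum_dist_destination_le H v₀ home α β hD hσ s
  have hleft := card_leftovers_le H home α β hβ hαβ
  have hobj := t.walkLength_le G
  have hopt := ceil_mul_optTour_le H v₀ home α β (by linarith) s
  set h : ℝ := (topLevel G σ : ℝ)
  have hh : 0 ≤ h := Nat.cast_nonneg _
  set W := G.walkLength s.objWalk
  set X := s.txnLength
  have hW : 0 ≤ W := G.walkLength_nonneg _
  have hX : 0 ≤ X := sum_nonneg fun T _ => G.walkLength_nonneg _
  have hC : s.cost α β = α * W + β * X := rfl
  set B := totalRadius H home α β
  have hB0 : 0 ≤ B := sum_nonneg fun l _ => sum_nonneg fun T _ =>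
    mul_nonneg (le_min (by linarith) (by positivity)) (by linarith)
  set γ : ℝ := (⌈α / β⌉₊ : ℝ)
  have hγ : α ≤ β * γ := by
    have := Nat.le_ceil (α / β)
    rwa [div_le_iff₀ hβ, mul_comm] at this
  have hγ0 : 0 < γ := by
    by_contra! hneg
    nlinarith
  have hcost : (globalAwareSingleObj H v₀ home α β t).cost α β =
      α * G.walkLength t.walk +
        β * ∑ T, G.dist (home T) (destination H v₀ home α β T) := by
    simp [Schedule.cost, globalAwareSingleObj, G.walkLength_shortestWalk]
  set O := optTour G (tourNodes H v₀ home α β) v₀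
  have hO : α * O ≤ 2 * (α * W) + β * (B + (h + 1) * X) := by
    have h1 : O ≤ 2 * W + (B + (h + 1) * X) / γ := by
      rw [← sub_le_iff_le_add', le_div_iff₀ hγ0]
      linarith
    have h2 : α * ((B + (h + 1) * X) / γ) ≤ β * (B + (h + 1) * X) := by
      rw [← mul_div_assoc, div_le_iff₀ hγ0]
      have := mul_le_mul_of_nonneg_right hγ (show 0 ≤ B + (h + 1) * X by positivity)
      linarith
    have h3 := mul_le_mul_of_nonneg_left h1 hα.le
    linarith
  have h4 : β * (#(leftovers H home α β) * W) ≤ (h + 2) * (8 * I) * (α * W) := by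
    have := mul_le_mul_of_nonneg_left (mul_le_mul_of_nonneg_right hleft hW) hβ.le
    refine this.trans (le_of_eq ?_)
    field_simp
  have h5 := mul_le_mul_of_nonneg_left hobj hα.le
  have h6 := mul_le_mul_of_nonneg_left htx hβ.le
  have hαW : 0 ≤ α * W := by positivity
  have hβX : 0 ≤ β * X := by positivity
  have hhW : 0 ≤ h * (α * W) := by positivity
  have hhX : 0 ≤ h * (β * X) := by positivity
  have hIX : 0 ≤ (h + 2) * (8 * I) * (β * X) := by positivity
  have hIC : 0 ≤ 64 * σ ^ 2 * I * s.cost α β := by rw [hC]; positivity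
  rw [hcost, hC]
  rw [hC] at hB hIC
  -- The radius term enters three times, twice through the factor 2 of the tour and once through the
  -- transactions: 192 = 3 · 64. The 7 is slack for the terms in W and X.
  linarith

end Analysis

/-- The number of levels is logarithmic in the diameter. -/
theorem topLevel_add_two_le {V : Type*} (G : WeightedGraph V) {σ : ℝ} (hσ : 1 ≤ σ)
    (hD : 2 ≤ G.diam) : (topLevel G σ : ℝ) + 2 ≤ 7 * Real.log G.diam := by
  have hlog2 : 1 / 2 ≤ Real.log G.diam := by
    have h1 := Real.log_two_gt_d9
    have h2 := Real.log_le_log two_pos hD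
    linarith
  have hlog4 : 1 ≤ Real.log (4 * σ) := by
    have h1 := Real.log_two_gt_d9
    have h2 : Real.log 4 = 2 * Real.log 2 := by
      rw [show (4 : ℝ) = 2 ^ 2 by norm_num, Real.log_pow]
      norm_num
    have h3 : Real.log 4 ≤ Real.log (4 * σ) := Real.log_le_log (by norm_num) (by linarith)
    linarith
  have h4 : Real.logb (4 * σ) G.diam ≤ Real.log G.diam :=
    div_le_self (by linarith) hlog4
  have h5 : 0 ≤ Real.logb (4 * σ) G.diam := div_nonneg (by linarith) (by linarith)
  have h6 := Nat.ceil_lt_add_one h5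
  have h7 : (topLevel G σ : ℝ) = (⌈Real.logb (4 * σ) G.diam⌉₊ : ℝ) := rfl
  -- h + 2 ≤ log D + 3, and 3 ≤ 6 log D because log D ≥ 1/2.
  linarith

end DualFlow

end

theorem mainTheorem2 (δ : ℝ) :
    (∃ (σ : ℝ) (I : ℕ), 1 ≤ σ ∧
      ∀ (V : Type*) [Fintype V] [DecidableEq V] (G : DualFlow.WeightedGraph V),
        G.DoublingDimLE δ → Nonempty (DualFlow.Hierarchy G σ I)) ∧
    ∀ (σ : ℝ) (I : ℕ), 1 ≤ σ →
      ∃ K : ℝ,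
        ∀ (V τ : Type*) [Fintype V] [DecidableEq V] [Fintype τ]
          (G : DualFlow.WeightedGraph V) (H : DualFlow.Hierarchy G σ I)
          (v₀ : V) (home : τ → V) (α β : ℝ),
          G.DoublingDimLE δ →
          (∀ u v : V, u ≠ v → 1 ≤ G.dist u v) →
          2 ≤ G.diam →
          Function.Injective home →
          0 < β → β < α →
          Nonempty (DualFlow.MSTTour G (DualFlow.tourNodes H v₀ home α β) v₀) ∧
          ∀ t : DualFlow.MSTTour G (DualFlow.tourNodes H v₀ home α β) v₀,
            G.walkLength t.walk ≤
              2 * DualFlow.optTour G (DualFlow.tourNodes H v₀ home α β) v₀ ∧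
            (DualFlow.globalAwareSingleObj H v₀ home α β t).cost α β ≤
              K * Real.log G.diam * DualFlow.optCost G v₀ home α β := by
  refine ⟨⟨2, ⌊(2 : ℝ) ^ δ * (2 : ℝ) ^ δ⌋₊, one_le_two,
    fun V _ _ G hG => DualFlow.nonempty_hierarchy G hG⟩, fun σ I hσ => ?_⟩
  refine ⟨7 * (192 * σ ^ 2 * I + 8 * I + 7), ?_⟩
  intro V τ _ _ _ G H v₀ home α β _ hsep hD hinj hβ hαβ
  refine ⟨DualFlow.nonempty_mstTour G (mem_insert_self _ _), fun t => ⟨t.walkLength_le G, ?_⟩⟩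
  set M := 7 * (192 * σ ^ 2 * I + 8 * I + 7) * Real.log G.diam
  have hlog : 0 < Real.log G.diam := Real.log_pos (by linarith)
  have hM : 0 < M := by positivity
  have : Nonempty (DualFlow.Schedule G v₀ home) :=
    ⟨DualFlow.globalAwareSingleObj H v₀ home α β t⟩
  -- `optCost` is an infimum, so the positive factor is moved away and each schedule is compared
  -- separately.
  rw [← div_le_iff₀' hM]
  refine le_ciInf fun s => ?_
  rw [div_le_iff₀' hM]
  refine (DualFlow.cost_globalAwareSingleObj_le H v₀ home α β hσ hsep hD hinj hβ hαβ t s).trans ?_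
  refine mul_le_mul_of_nonneg_right ?_ (s.cost_nonneg (hβ.trans hαβ).le hβ.le)
  have := mul_le_mul_of_nonneg_right (DualFlow.topLevel_add_two_le G hσ hD)
    (show 0 ≤ 192 * σ ^ 2 * (I : ℝ) + 8 * I + 7 by positivity)
  simp only [M]
  linarith
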